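/- Let $(\alpha_n)_{n\ge1}$ be integers with $\alpha_n\ge 2$, let $A_n=\{0,\dots,\alpha_n-1\}$, and let $X=\prod_{n\ge1}A_n$ with its product topology and Borel $\sigma$-algebra. The odometer $f:X\to X$ is addition of $1$ in the first coordinate with carry to the right: $f(\alpha_1-1,\alpha_2-1,\dots)=(0,0,\dots)$, and for every other $x$, with $l=\min\{j\ge 1: x_j\ne\alpha_j-1\}$, one has $f(x)_n=0$ for $n<l$, $f(x)_l=x_l+1$, and $f(x)_n=x_n$ for $n>l$. For each $n$ let $\mu_n$ be a probability measure on $A_n$ with $\mu_n(\{a\})>0$ for all $a\in A_n$, assume that $\prod_{n\ge1}\max_{a\in A_n}\mu_n(\{a\})=0$, and let $\mu=\prod_{n\ge1}\mu_n$ be the product measure on $X$. Let $\mathbb K$ be $\mathbb R$ or $\mathbb C$, let $1\le p<\infty$, and suppose that the composition operator $T_f\varphi=\varphi\circ f$ is a continuous linear operator $L^p(X,\mu;\mathbb K)\to L^p(X,\mu;\mathbb K)$. Then the following are equivalent: 1. $T_f$ is Li–Yorke chaotic: there is $\varphi\in L^p$ with $\liminf_{n\to\infty}\|T_f^n\varphi\|=0$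 and $\limsup_{n\to\infty}\|T_f^n\varphi\|=\infty$; 2. $T_f$ is supercyclic: there is $\varphi\in L^p$ such that $\{\lambda T_f^n\varphi:\lambda\in\mathbb K,\ n\ge1\}$ is dense in $L^p$; 3. $T_f$ is hypercyclic: there is $\varphi\in L^p$ such that $\{T_f^n\varphi: n\ge1\}$ is dense in $L^p$; 4. $T_f$ is Devaney chaotic: $T_f$ is hypercyclic and the set of its periodic points (those $\varphi$ with $T_f^n\varphi=\varphi$ for some $n\ge1$) is dense in $L^p$. -/

import Mathlib

open MeasureTheory Filter Topology
open scoped ENNReal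

namespace LinearDynamics

variable {𝕜 E : Type*} [RCLike 𝕜] [NormedAddCommGroup E] [NormedSpace 𝕜 E]

/-- Some vector `x` has a dense projective orbit `{c • T ^ n x : c ∈ 𝕜, n ≥ 1}`. -/
def IsSupercyclic (T : E →L[𝕜] E) : Prop :=
  ∃ x : E, Dense {y : E | ∃ c : 𝕜, ∃ n : ℕ, 1 ≤ n ∧ y = c • (T ^ n) x}

/-- Some vector `x` has a dense orbit `{T ^ n x : n ≥ 1}`. -/
def IsHypercyclic (T : E →L[𝕜] E) : Prop :=
  ∃ x : E, Dense {y : E | ∃ n : ℕ, 1 ≤ n ∧ y = (T ^ n) x}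

/-- Hypercyclicity together with density of the set of periodic vectors. -/
def IsDevaneyChaotic (T : E →L[𝕜] E) : Prop :=
  IsHypercyclic T ∧ Dense {y : E | ∃ n : ℕ, 1 ≤ n ∧ (T ^ n) y = y}

/-- Some vector `x` satisfies `liminf ‖T ^ n x‖ = 0` and `limsup ‖T ^ n x‖ = ∞`. The norms are
taken with values in `[0, ∞]`, so that both limits always make sense. -/
def IsLiYorkeChaotic (T : E →L[𝕜] E) : Prop :=
  ∃ x : E, liminf (fun n : ℕ => ‖(T ^ n) x‖ₑ) atTop = 0 ∧
    limsup (fun n : ℕ => ‖(T ^ n) x‖ₑ) atTop = ∞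

/-- The bounded operator `T` on `L^p(μ)` is the composition operator `φ ↦ φ ∘ f`. As `φ` runs
over all `p`-integrable functions and not only over one representative of each class, this
includes that `φ ↦ φ ∘ f` is well defined on classes; `T` is determined by `f`. -/
def IsCompositionOperator {X : Type*} [MeasurableSpace X] {μ : Measure X} {p : ℝ≥0∞}
    [Fact (1 ≤ p)] (f : X → X) (T : Lp 𝕜 p μ →L[𝕜] Lp 𝕜 p μ) : Prop :=
  ∀ (φ : X → 𝕜) (hφ : MemLp φ p μ), T (hφ.toLp φ) =ᵐ[μ] φ ∘ f

end LinearDynamics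

/-- The odometer on `∏ n, {0, …, α n - 1}`: add one to the first coordinate and carry to the
right. The `n`-th coordinate is increased by one modulo `α n` if all previous coordinates are
maximal, and is unchanged otherwise. In particular `(α n - 1)ₙ` is sent to `(0, 0, …)`. -/
def odometer (α : ℕ → ℕ) (x : ∀ n, Fin (α n)) : ∀ n, Fin (α n) := fun n =>
  if ∀ j < n, (x j : ℕ) + 1 = α j then ⟨((x n : ℕ) + 1) % α n, Nat.mod_lt _ (x n).pos⟩ else x n

/-!
Write `f` for the odometer, `μ` for the product measure, and `P k = α 0 * ⋯ * α (k - 1)`. All four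
properties are shown to be equivalent to hypercyclicity, by way of the following property of `f`
(`LinearDynamics.IsRunaway`): for every `ε > 0` there are `n` and a set `B` of measure more than
`1 - ε` with `μ (f⁻ⁿ B) < ε`.

*The odometer is periodic on finitely many digits.* Read in mixed radix, the first `k` digits are
increased by `1` modulo `P k` (`digitValue_odometer`), so functions of these digits are fixed by
`T ^ P k`. They are dense in `L^p` (`dense_boundedPeriodic_odometer`). Hence periodic vectors are
always dense, and a hypercyclic `T` is Devaney chaotic.

*A runaway `f` gives a hypercyclic `T`.* For bounded periodic `g₁` and `g₂`, the function equal to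
`g₁` on `B` and to `g₂ ∘ f⁻ⁿ` off `B` is close to `g₁`, and `T ^ n` maps it close to `g₂`; so `T` is
topologically transitive and Birkhoff's theorem applies (`isHypercyclic_of_isRunaway`).

*A Li–Yorke chaotic `T` gives a runaway `f`.* If `φ ≠ 0` and `liminf ‖T ^ n φ‖ = 0`, a superlevel
set `B` of `|φ|` has positive measure and preimages of arbitrarily small measure. By Kolmogorov's
zero-one law, almost every point agrees with a point of `B` in all but finitely many digits, so for
large `k` the points that agree with a point of `B` from the `k`-th digit on have measure close to `1`.
Changing the first `k` digits amounts to moving by less than `P k` steps along an orbit, and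
boundedness of `T` controls the cost of that many steps (`isRunaway_odometer`).

*A supercyclic `T` gives a runaway `f`.* Here `μ` has to be nonatomic. Multiples of elements of one
orbit approximate both the constant `1` and a function whose level sets are small and whose values
`4 ^ m` are far apart. One of the two comes first in the orbit, and some multiple of it is carried by
an iterate of `f` to the other up to small errors. A function that is nearly constant cannot be close
to one with spread-out values, except on a single level set (`isRunaway_of_isSupercyclic`).

Finally, a dense orbit in a nontrivial space comes back infinitely often to small norms and to large
norms, so hypercyclic operators are Li–Yorke chaotic.
-/

/-! ### Arithmetic of the odometer -/

section Odometer

variable {α : ℕ → ℕ}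

/-- The mixed-radix value of the first `k` digits of `x`, the `0`-th digit being the least
significant one. -/
def digitValue (k : ℕ) (x : ∀ n, Fin (α n)) : ℕ :=
  ∑ i ∈ Finset.range k, (x i : ℕ) * ∏ j ∈ Finset.range i, α j

/-- Replace the first `k` digits by `0`. -/
def clearHead (k : ℕ) (x : ∀ n, Fin (α n)) : ∀ n, Fin (α n) :=
  fun n => if n < k then ⟨0, (x n).pos⟩ else x n

/-- Replace all digits from the `k`-th one on by `0`. -/
def clearTail (k : ℕ) (x : ∀ n, Fin (α n)) : ∀ n, Fin (α n) :=
  fun n => if n < k then x n else ⟨0, (x n).pos⟩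

lemma digitValue_succ (k : ℕ) (x : ∀ n, Fin (α n)) :
    digitValue (k + 1) x = digitValue k x + x k * ∏ j ∈ Finset.range k, α j :=
  Finset.sum_range_succ _ _

lemma digitValue_lt (k : ℕ) (x : ∀ n, Fin (α n)) :
    digitValue k x < ∏ j ∈ Finset.range k, α j := by
  induction k with
  | zero => simp [digitValue]
  | succ k ih =>
    rw [digitValue_succ, Finset.prod_range_succ]
    have h : (x k : ℕ) + 1 ≤ α k := (x k).2
    nlinarith [Nat.mul_le_mul_left (∏ j ∈ Finset.range k, α j) h]

lemma digitValue_injOn {k : ℕ} {x y : ∀ n, Fin (α n)} (h : digitValue k x = digitValue k y) :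
    ∀ j < k, x j = y j := by
  induction k with
  | zero => simp
  | succ k ih =>
    rw [digitValue_succ, digitValue_succ] at h
    have hx := digitValue_lt k x
    have hy := digitValue_lt k y
    have h0 : 0 < ∏ j ∈ Finset.range k, α j := by omega
    have h1 : (x k : ℕ) = y k := by
      have := congrArg (· / ∏ j ∈ Finset.range k, α j) h
      simpa [Nat.add_mul_div_right _ _ h0, Nat.div_eq_of_lt hx, Nat.div_eq_of_lt hy] using this
    have h2 : digitValue k x = digitValue k y := by rw [h1] at h; omega
    intro j hj
    rcases Nat.lt_succ_iff_lt_or_eq.1 hj with hj | rfl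
    · exact ih h2 j hj
    · exact Fin.ext h1

lemma digitValue_clearHead (k : ℕ) (x : ∀ n, Fin (α n)) : digitValue k (clearHead k x) = 0 :=
  Finset.sum_eq_zero fun i hi => by simp [clearHead, Finset.mem_range.1 hi]

lemma clearHead_of_le {k n : ℕ} (h : k ≤ n) (x : ∀ n, Fin (α n)) : clearHead k x n = x n := by
  simp [clearHead, h]

/-- The odometer adds `1` to the value of the first `k` digits, unless all of them are maximal. -/
lemma digitValue_odometer_aux (k : ℕ) (x : ∀ n, Fin (α n)) :
    ((∀ j < k, (x j : ℕ) + 1 = α j) → digitValue k x + 1 = ∏ j ∈ Finset.range k, α j ∧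
      digitValue k (odometer α x) = 0) ∧
    ((¬ ∀ j < k, (x j : ℕ) + 1 = α j) → digitValue k (odometer α x) = digitValue k x + 1) := by
  induction k with
  | zero => simp [digitValue]
  | succ k ih =>
    rw [digitValue_succ, digitValue_succ, Finset.prod_range_succ]
    by_cases h : ∀ j < k, (x j : ℕ) + 1 = α j
    · obtain ⟨h1, h2⟩ := ih.1 h
      have h3 : (odometer α x k : ℕ) = ((x k : ℕ) + 1) % α k := by simp [odometer, if_pos h]
      rw [h2, h3, ← h1]
      by_cases h4 : (x k : ℕ) + 1 = α k
      · refine ⟨fun _ => ⟨by linear_combination (digitValue k x + 1) * h4, by simp [h4]⟩,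
          fun h5 => (h5 ?_).elim⟩
        intro j hj
        rcases Nat.lt_succ_iff_lt_or_eq.1 hj with hj | rfl
        · exact h j hj
        · exact h4
      · refine ⟨fun h5 => (h4 (h5 k k.lt_succ_self)).elim, fun _ => ?_⟩
        have : (x k : ℕ) + 1 < α k := lt_of_le_of_ne (x k).2 h4
        rw [Nat.mod_eq_of_lt this]; ring
    · refine ⟨fun h5 => (h fun j hj => h5 j (hj.trans k.lt_succ_self)).elim, fun _ => ?_⟩
      have h3 : odometer α x k = x k := if_neg h
      rw [ih.2 h, h3]; ring

/-- On the first `k` digits the odometer is addition of `1` modulo `α 0 * ⋯ * α (k - 1)`. -/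
lemma digitValue_odometer (k : ℕ) (x : ∀ n, Fin (α n)) :
    digitValue k (odometer α x) = (digitValue k x + 1) % ∏ j ∈ Finset.range k, α j := by
  by_cases h : ∀ j < k, (x j : ℕ) + 1 = α j
  · obtain ⟨h1, h2⟩ := (digitValue_odometer_aux k x).1 h
    rw [h2, h1, Nat.mod_self]
  · have h1 := (digitValue_odometer_aux k x).2 h
    rw [← h1, Nat.mod_eq_of_lt (digitValue_lt k _)]

lemma digitValue_odometer_iterate (k n : ℕ) (x : ∀ n, Fin (α n)) :
    digitValue k ((odometer α)^[n] x) = (digitValue k x + n) % ∏ j ∈ Finset.range k, α j := by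
  induction n with
  | zero => simp [Nat.mod_eq_of_lt (digitValue_lt k x)]
  | succ n ih =>
    rw [Function.iterate_succ_apply', digitValue_odometer, ih, Nat.mod_add_mod, add_assoc]

/-- No digit from the `k`-th one on changes as long as the first `k` digits do not overflow. -/
lemma odometer_iterate_apply_of_le {k n m : ℕ} (hm : k ≤ m) (x : ∀ n, Fin (α n))
    (h : digitValue k x + n < ∏ j ∈ Finset.range k, α j) : (odometer α)^[n] x m = x m := by
  induction n with
  | zero => rfl
  | succ n ih =>
    rw [Function.iterate_succ_apply', ← ih (by omega)]
    refine if_neg fun h1 => ?_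
    have h2 := ((digitValue_odometer_aux k _).1 fun j hj => h1 j (hj.trans_le hm)).1
    rw [digitValue_odometer_iterate, Nat.mod_eq_of_lt (by omega)] at h2
    omega

/-- A point is reached from any point with the same tail whose first `k` digits are cleared. -/
lemma odometer_iterate_clearHead {k : ℕ} {x y : ∀ n, Fin (α n)} (h : ∀ n, k ≤ n → y n = x n) :
    (odometer α)^[digitValue k y] (clearHead k x) = y := by
  have h0 : digitValue k (clearHead k x) + digitValue k y < ∏ j ∈ Finset.range k, α j := by
    rw [digitValue_clearHead, zero_add]; exact digitValue_lt k y
  funext n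
  rcases lt_or_ge n k with hn | hn
  · refine digitValue_injOn (k := k) ?_ n hn
    rw [digitValue_odometer_iterate, Nat.mod_eq_of_lt h0, digitValue_clearHead, zero_add]
  · rw [odometer_iterate_apply_of_le hn _ h0, clearHead_of_le hn, h n hn]

lemma odometer_injective (α : ℕ → ℕ) : Function.Injective (odometer α) := by
  intro x y h
  funext n
  induction n using Nat.strong_induction_on with
  | _ n ih =>
    have h1 := congrFun h n
    have hc : (∀ j < n, (x j : ℕ) + 1 = α j) ↔ ∀ j < n, (y j : ℕ) + 1 = α j :=
      forall₂_congr fun j hj => by rw [ih j hj]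
    by_cases hx : ∀ j < n, (x j : ℕ) + 1 = α j
    · simp only [odometer, if_pos hx, if_pos (hc.1 hx), Fin.mk.injEq] at h1
      have : (x n : ℕ) ≡ y n [MOD α n] := Nat.ModEq.add_right_cancel' 1 h1
      exact Fin.ext (this.eq_of_lt_of_lt (x n).2 (y n).2)
    · simpa only [odometer, if_neg hx, if_neg (hc.not.1 hx)] using h1

lemma clearTail_odometer_iterate (k : ℕ) (x : ∀ n, Fin (α n)) :
    clearTail k ((odometer α)^[∏ j ∈ Finset.range k, α j] x) = clearTail k x := by
  have h := digitValue_injOn (k := k) (x := (odometer α)^[∏ j ∈ Finset.range k, α j] x) (y := x)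
    (by rw [digitValue_odometer_iterate, Nat.add_mod_right, Nat.mod_eq_of_lt (digitValue_lt k x)])
  funext n
  by_cases hn : n < k
  · simp [clearTail, hn, h n hn]
  · simp [clearTail, hn]

/-! ### Measurability and continuity of digit maps -/

lemma measurable_digitValue (k : ℕ) : Measurable (digitValue (α := α) k) :=
  Finset.measurable_sum _ fun i _ =>
    (measurable_of_countable fun a : Fin (α i) => (a : ℕ) * ∏ j ∈ Finset.range i, α j).comp
      (measurable_pi_apply i)

lemma measurable_odometer (α : ℕ → ℕ) : Measurable (odometer α) := by
  refine measurable_pi_lambda _ fun n => Measurable.ite ?_ ?_ (measurable_pi_apply n)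
  · have : {x : ∀ n, Fin (α n) | ∀ j < n, (x j : ℕ) + 1 = α j} =
        ⋂ j, ⋂ _ : j < n, (fun x => x j) ⁻¹' {a : Fin (α j) | (a : ℕ) + 1 = α j} := by
      ext; simp
    rw [this]
    exact .iInter fun j => .iInter fun _ => measurable_pi_apply j (Set.toFinite _).measurableSet
  · exact (measurable_of_countable fun a : Fin (α n) =>
      (⟨((a : ℕ) + 1) % α n, Nat.mod_lt _ a.pos⟩ : Fin (α n))).comp (measurable_pi_apply n)

lemma continuous_clearTail (k : ℕ) : Continuous (clearTail (α := α) k) := by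
  refine continuous_pi fun n => ?_
  by_cases hn : n < k
  · simpa [clearTail, hn] using continuous_apply n
  · simp only [clearTail, hn, if_false]
    exact (continuous_of_discreteTopology (f := fun a : Fin (α n) => (⟨0, a.pos⟩ : Fin (α n)))).comp
      (continuous_apply n)

lemma tendsto_clearTail (x : ∀ n, Fin (α n)) :
    Tendsto (fun k => clearTail k x) atTop (𝓝 x) := by
  refine tendsto_pi_nhds.2 fun n => tendsto_const_nhds.congr' ?_
  filter_upwards [eventually_gt_atTop n] with k hk
  simp [clearTail, hk]

/-- `clearHead k` only depends on the digits from the `k`-th one on. -/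
lemma measurable_clearHead_tail (k : ℕ) :
    Measurable[⨆ i ≥ k, MeasurableSpace.comap (fun x : ∀ n, Fin (α n) => x i) inferInstance]
      (clearHead (α := α) k) := by
  refine @measurable_pi_lambda _ _ _ (_) _ _ fun n => ?_
  by_cases hn : n < k
  · rcases isEmpty_or_nonempty (∀ n, Fin (α n)) with h | ⟨⟨x⟩⟩
    · exact @measurable_of_empty _ _ (_) _ h _
    · have : (fun y : ∀ n, Fin (α n) => clearHead k y n) = fun _ => ⟨0, (x n).pos⟩ := by
        funext y; simp [clearHead, hn]
      rw [this]
      exact @measurable_const _ _ _ (_) _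
  · have : (fun y : ∀ n, Fin (α n) => clearHead k y n) = fun y => y n := by
      funext y; simp [clearHead, hn]
    rw [this]
    exact (comap_measurable _).mono (le_iSup₂_of_le n (not_lt.1 hn) le_rfl) le_rfl

lemma measurable_clearHead (k : ℕ) : Measurable (clearHead (α := α) k) :=
  (measurable_clearHead_tail k).mono
    (iSup₂_le fun i _ => (measurable_pi_apply i).comap_le) le_rfl

/-! ### Tail saturation and the zero-one law -/

/-- The points that agree from the `k`-th digit on with some point of `B`. -/
def tailSaturation (k : ℕ) (B : Set (∀ n, Fin (α n))) : Set (∀ n, Fin (α n)) :=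
  {x | ∃ y ∈ B, ∀ n, k ≤ n → y n = x n}

lemma measurableSet_tailSaturation (k : ℕ) {B : Set (∀ n, Fin (α n))} (hB : MeasurableSet B) :
    MeasurableSet (tailSaturation k B) := by
  have : tailSaturation k B = ⋃ i, ⋃ _ : i < ∏ j ∈ Finset.range k, α j,
      (fun x => (odometer α)^[i] (clearHead k x)) ⁻¹' B := by
    ext x
    simp only [tailSaturation, Set.mem_ofPred_eq, Set.mem_iUnion, Set.mem_preimage, exists_prop]
    constructor
    · rintro ⟨y, hy, h⟩
      exact ⟨_, digitValue_lt k y, by rwa [odometer_iterate_clearHead h]⟩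
    · rintro ⟨i, hi, h⟩
      refine ⟨_, h, fun n hn => ?_⟩
      rw [odometer_iterate_apply_of_le hn _ (by rwa [digitValue_clearHead, zero_add]),
        clearHead_of_le hn]
  rw [this]
  exact .iUnion fun i => .iUnion fun _ =>
    ((measurable_odometer α).iterate i).comp (measurable_clearHead k) hB

lemma monotone_tailSaturation (B : Set (∀ n, Fin (α n))) :
    Monotone fun k => tailSaturation k B :=
  fun _ _ hkl _ ⟨y, hy, h⟩ => ⟨y, hy, fun n hn => h n (hkl.trans hn)⟩

/-- A point whose orbit is in the saturation of `B` at time `n + α 0 * ⋯ * α (k - 1)` visits `B`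
at some time `n + j` with `j` bounded in terms of `k` only. -/
lemma preimage_tailSaturation_subset (k n : ℕ) (B : Set (∀ n, Fin (α n))) :
    (odometer α)^[n + ∏ j ∈ Finset.range k, α j] ⁻¹' tailSaturation k B ⊆
      ⋃ j ∈ Finset.range (2 * ∏ j ∈ Finset.range k, α j), (odometer α)^[n + j] ⁻¹' B := by
  rintro z ⟨y, hy, h⟩
  set P := ∏ j ∈ Finset.range k, α j
  set w := (odometer α)^[n + P] z
  have hw := digitValue_lt k w
  have hy' := digitValue_lt k y
  have h1 : (odometer α)^[n + P - digitValue k w] z = clearHead k w := by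
    refine (odometer_injective α).iterate (digitValue k w) ?_
    rw [odometer_iterate_clearHead fun _ _ => rfl, ← Function.iterate_add_apply,
      Nat.add_sub_cancel' (by omega)]
  have h2 : (odometer α)^[n + (digitValue k y + (P - digitValue k w))] z = y := by
    rw [show n + (digitValue k y + (P - digitValue k w)) =
      digitValue k y + (n + P - digitValue k w) by omega, Function.iterate_add_apply, h1,
      odometer_iterate_clearHead h]
  refine Set.mem_biUnion (x := digitValue k y + (P - digitValue k w)) ?_ ?_
  · simp only [Finset.coe_range, Set.mem_Iio]; omega
  · rw [Set.mem_preimage, h2]; exact hy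

section ProductMeasure

variable (ν : ∀ n, Measure (Fin (α n))) [∀ n, IsProbabilityMeasure (ν n)]

/-- Kolmogorov's zero-one law: a set of positive measure meets almost every tail class. -/
lemma measure_iUnion_tailSaturation {B : Set (∀ n, Fin (α n))} (hB : MeasurableSet B)
    (h0 : Measure.infinitePi ν B ≠ 0) :
    Measure.infinitePi ν (⋃ k, tailSaturation k B) = 1 := by
  have hE : MeasurableSet (⋃ k, tailSaturation k B) :=
    .iUnion fun k => measurableSet_tailSaturation k hB
  have hind : ProbabilityTheory.iIndep
      (fun i => MeasurableSpace.comap (fun x : ∀ n, Fin (α n) => x i) inferInstance)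
      (Measure.infinitePi ν) :=
    ProbabilityTheory.iIndepFun_infinitePi (P := ν) (X := fun i a => a) (fun i => measurable_id)
  refine (ProbabilityTheory.measure_zero_or_one_of_measurableSet_limsup_atTop
    (fun i => (measurable_pi_apply i).comap_le) hind ?_).resolve_left fun h => h0 ?_
  · rw [limsup_eq_iInf_iSup_of_nat, MeasurableSpace.measurableSet_iInf]
    intro k
    -- membership in the set is not affected by clearing the first `k` digits
    have : ⋃ k, tailSaturation k B = clearHead k ⁻¹' ⋃ k, tailSaturation k B := by
      ext x
      simp only [tailSaturation, Set.mem_iUnion, Set.mem_preimage, Set.mem_ofPred_eq]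
      constructor
      · rintro ⟨l, y, hy, h⟩
        exact ⟨max k l, y, hy, fun n hn => by
          rw [clearHead_of_le ((le_max_left _ _).trans hn), h n ((le_max_right _ _).trans hn)]⟩
      · rintro ⟨l, y, hy, h⟩
        exact ⟨max k l, y, hy, fun n hn => by
          rw [h n ((le_max_right _ _).trans hn), clearHead_of_le ((le_max_left _ _).trans hn)]⟩
    rw [this]
    exact measurable_clearHead_tail k hE
  · have hsub : B ⊆ ⋃ k, tailSaturation k B :=
      fun x hx => Set.mem_iUnion.2 ⟨0, x, hx, fun _ _ => rfl⟩
    exact measure_mono_null hsub h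

/-- A fibre of `digitValue k` is a cylinder over `k` digits. -/
lemma measure_digitValue_fiber_le (k m : ℕ) :
    Measure.infinitePi ν (digitValue k ⁻¹' {m}) ≤
      ∏ n ∈ Finset.range k, ⨆ a : Fin (α n), ν n {a} := by
  rcases (digitValue (α := α) k ⁻¹' {m}).eq_empty_or_nonempty with h | ⟨y, hy⟩
  · simp [h]
  · have hsub : digitValue k ⁻¹' {m} ⊆ Set.pi (Finset.range k) fun n => {y n} := by
      intro x hx n hn
      exact digitValue_injOn (k := k) (hx.trans hy.symm) n (by simpa using hn)
    refine (measure_mono hsub).trans ?_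
    rw [Measure.infinitePi_pi _ fun n _ => measurableSet_singleton _]
    exact Finset.prod_le_prod' fun n _ => le_iSup (fun a => ν n {a}) (y n)

end ProductMeasure

end Odometer

namespace LinearDynamics

/-! ### Dense orbits in normed spaces -/

section NormedSpace

variable {𝕜 E : Type*} [RCLike 𝕜] [NormedAddCommGroup E] [NormedSpace 𝕜 E] {T : E →L[𝕜] E}

lemma IsHypercyclic.isSupercyclic (h : IsHypercyclic T) : IsSupercyclic T := by
  obtain ⟨x, hx⟩ := h
  refine ⟨x, hx.mono ?_⟩
  rintro y ⟨n, hn, rfl⟩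
  exact ⟨1, n, hn, (one_smul _ _).symm⟩

lemma frequently_mem_of_dense_orbit [Nontrivial E] {x : E}
    (hx : Dense {y : E | ∃ n : ℕ, 1 ≤ n ∧ y = (T ^ n) x}) {V : Set E} (hV : IsOpen V)
    (hne : V.Nonempty) : ∃ᶠ n in atTop, (T ^ n) x ∈ V := by
  refine frequently_atTop.2 fun N => ?_
  have : ∀ y : E, (𝓝[≠] y).NeBot := Module.punctured_nhds_neBot 𝕜 E
  -- a dense set stays dense when finitely many points are removed
  obtain ⟨y, ⟨⟨n, -, rfl⟩, hn⟩, hyV⟩ := (hx.sdiff_finite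
    ((Set.finite_lt_nat N).image fun n => (T ^ n) x)).exists_mem_open hV hne
  exact ⟨n, not_lt.1 fun h => hn ⟨n, h, rfl⟩, hyV⟩

lemma IsHypercyclic.isLiYorkeChaotic [Nontrivial E] (h : IsHypercyclic T) :
    IsLiYorkeChaotic T := by
  obtain ⟨x, hx⟩ := h
  refine ⟨x, ?_, ?_⟩
  · by_contra h0
    obtain ⟨c, hc0, hc⟩ := exists_between (pos_iff_ne_zero.2 h0)
    obtain ⟨n, hn1, hn2⟩ := ((frequently_mem_of_dense_orbit hx
      (V := {y | ‖y‖ₑ < c}) (isOpen_lt continuous_enorm continuous_const)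
      ⟨0, by simpa using hc0⟩).and_eventually (eventually_lt_of_lt_liminf hc)).exists
    exact lt_asymm hn1 hn2
  · by_contra h0
    obtain ⟨c, hc, hc0⟩ := exists_between (lt_top_iff_ne_top.2 h0)
    obtain ⟨y, hy⟩ := NormedSpace.exists_lt_norm 𝕜 E c.toReal
    obtain ⟨n, hn1, hn2⟩ := ((frequently_mem_of_dense_orbit hx
      (V := {y | c < ‖y‖ₑ}) (isOpen_lt continuous_const continuous_enorm)
      ⟨y, by
        rw [Set.mem_ofPred_eq, ← ofReal_norm]
        exact (ENNReal.lt_ofReal_iff_toReal_lt hc0.ne).2 hy⟩).and_eventually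
      (eventually_lt_of_limsup_lt hc)).exists
    exact lt_asymm hn1 hn2

/-- **Birkhoff's transitivity theorem**: a topologically transitive operator on a separable Banach
space has a dense orbit. -/
lemma isHypercyclic_of_transitive [CompleteSpace E] [SecondCountableTopology E]
    (h : ∀ U V : Set E, IsOpen U → IsOpen V → U.Nonempty → V.Nonempty →
      ∃ n : ℕ, 1 ≤ n ∧ ∃ x ∈ U, (T ^ n) x ∈ V) : IsHypercyclic T := by
  obtain ⟨b, hbc, hb0, hb⟩ := TopologicalSpace.exists_countable_basis E
  have hd : Dense (⋂ V ∈ b, ⋃ n : ℕ, ⋃ _ : 1 ≤ n, (T ^ n) ⁻¹' V) := by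
    refine dense_biInter_of_isOpen (fun V hV => ?_) hbc fun V hV => ?_
    · exact isOpen_iUnion fun n => isOpen_iUnion fun _ =>
        (hb.isOpen hV).preimage (T ^ n).continuous
    · refine dense_iff_inter_open.2 fun U hU hUne => ?_
      obtain ⟨n, hn, x, hxU, hxV⟩ := h U V hU (hb.isOpen hV) hUne
        (Set.nonempty_iff_ne_empty.2 fun h0 => hb0 (h0 ▸ hV))
      exact ⟨x, hxU, Set.mem_iUnion₂.2 ⟨n, hn, hxV⟩⟩
  obtain ⟨x, hx⟩ := hd.nonempty
  refine ⟨x, hb.dense_iff.2 fun V hV _ => ?_⟩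
  obtain ⟨n, hn, hxn⟩ := Set.mem_iUnion₂.1 (Set.mem_iInter₂.1 hx V hV)
  exact ⟨_, hxn, n, hn, rfl⟩

/-- The powers of `4` are so far apart that at most one of them is close to a given scalar. -/
lemma eq_of_norm_sub_four_pow_lt {d : 𝕜} {s t : ℕ} (hs : ‖d - 4 ^ s‖ < ‖d‖ / 8 + 1 / 8)
    (ht : ‖d - 4 ^ t‖ < ‖d‖ / 8 + 1 / 8) : s = t := by
  wlog hst : s < t generalizing s t
  · rcases lt_trichotomy s t with h | h | h
    · exact this hs ht h
    · exact h
    · exact (this ht hs h).symm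
  exfalso
  have hn : ∀ m : ℕ, ‖(4 : 𝕜) ^ m‖ = 4 ^ m := fun m => by rw [norm_pow, RCLike.norm_ofNat]
  have h1 : (1 : ℝ) ≤ 4 ^ s := one_le_pow₀ (by norm_num)
  have h2 : (4 : ℝ) * 4 ^ s ≤ 4 ^ t := by
    rw [← pow_succ']; exact pow_le_pow_right₀ (by norm_num) hst
  have h3 : ‖d‖ ≤ ‖d - 4 ^ s‖ + 4 ^ s := by
    simpa [hn] using norm_add_le (d - 4 ^ s) (4 ^ s)
  have h4 : (4 : ℝ) ^ t ≤ ‖d‖ + ‖d - 4 ^ t‖ := by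
    simpa [hn] using norm_sub_le d (d - 4 ^ t)
  linarith

end NormedSpace

/-! ### Composition operators on `L^p` -/

section Composition

variable {𝕜 : Type*} [RCLike 𝕜] {X : Type*} [MeasurableSpace X] {μ : Measure X} {p : ℝ≥0∞}

/-- **Chebyshev's inequality**: a function of small `L^p` norm is small off a set of small
measure. -/
lemma measure_lt_of_eLpNorm_lt (hp0 : p ≠ 0) (hp : p ≠ ∞) {h : X → 𝕜}
    (hh : AEStronglyMeasurable h μ) {δ ε : ℝ≥0∞} (hlt : eLpNorm h p μ < δ * ε ^ (1 / p.toReal)) :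
    μ {x | δ ≤ ‖h x‖ₑ} < ε := by
  have hp' : 0 < p.toReal := ENNReal.toReal_pos hp0 hp
  by_contra hε
  refine hlt.not_ge ?_
  have h1 := (mul_le_mul_right (not_lt.1 hε) (δ ^ p.toReal)).trans
    (mul_meas_ge_le_pow_eLpNorm' μ hp0 hp hh δ)
  have h2 := ENNReal.rpow_le_rpow h1 (one_div_nonneg.2 hp'.le)
  rwa [ENNReal.mul_rpow_of_nonneg _ _ (one_div_nonneg.2 hp'.le), ← ENNReal.rpow_mul,
    ← ENNReal.rpow_mul, mul_one_div_cancel hp'.ne', ENNReal.rpow_one, ENNReal.rpow_one] at h2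

/-- A bounded function supported in a set of small measure has small `L^p` norm. -/
lemma eLpNorm_le_of_bound_of_support (hp0 : p ≠ 0) (hp : p ≠ ∞) {h : X → 𝕜} {M : ℝ} {S : Set X}
    (hS : MeasurableSet S) (hM : ∀ x, ‖h x‖ ≤ M) (h0 : ∀ x ∉ S, h x = 0) :
    eLpNorm h p μ ≤ ENNReal.ofReal M * μ S ^ (1 / p.toReal) := by
  rcases isEmpty_or_nonempty X with hX | ⟨⟨x₀⟩⟩
  · rw [show h = 0 from Subsingleton.elim _ _, eLpNorm_zero]; exact zero_le
  have hM0 : 0 ≤ M := (norm_nonneg _).trans (hM x₀)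
  rw [← Real.enorm_eq_ofReal hM0, ← eLpNorm_indicator_const hS hp0 hp]
  refine eLpNorm_mono fun x => ?_
  by_cases hx : x ∈ S
  · rw [Set.indicator_of_mem hx, Real.norm_of_nonneg hM0]; exact hM x
  · rw [h0 x hx, norm_zero]; exact norm_nonneg _

/-- Some set of almost full measure is pulled back by an iterate of `f` to a set of almost zero
measure. -/
def IsRunaway (f : X → X) (μ : Measure X) : Prop :=
  ∀ ε : ℝ≥0∞, 0 < ε →
    ∃ (B : Set X) (n : ℕ), MeasurableSet B ∧ μ Bᶜ < ε ∧ μ (f^[n] ⁻¹' B) < ε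

lemma IsRunaway.exists_one_le [IsProbabilityMeasure μ] {f : X → X} (h : IsRunaway f μ) {ε : ℝ≥0∞}
    (hε : 0 < ε) : ∃ (B : Set X) (n : ℕ), 1 ≤ n ∧ MeasurableSet B ∧ μ Bᶜ < ε ∧
      μ (f^[n] ⁻¹' B) < ε := by
  obtain ⟨B, n, hB, h1, h2⟩ := h (min ε 2⁻¹) (lt_min hε (by simp))
  refine ⟨B, n, Nat.one_le_iff_ne_zero.2 ?_, hB, h1.trans_le (min_le_left _ _),
    h2.trans_le (min_le_left _ _)⟩
  rintro rfl
  have h3 := ENNReal.add_lt_add (h1.trans_le (min_le_right _ _)) (h2.trans_le (min_le_right _ _))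
  rw [ENNReal.inv_two_add_inv_two, add_comm, Function.iterate_zero, Set.preimage_id,
    measure_add_measure_compl hB, measure_univ] at h3
  exact lt_irrefl _ h3

lemma measure_iterate_preimage_le {f : X → X} (hf : Measurable f) {C : ℝ≥0∞}
    (hC : ∀ S, MeasurableSet S → μ (f ⁻¹' S) ≤ C * μ S) {S : Set X} (hS : MeasurableSet S)
    (j : ℕ) : μ (f^[j] ⁻¹' S) ≤ C ^ j * μ S := by
  induction j with
  | zero => simp
  | succ j ih =>
    rw [Function.iterate_succ, Set.preimage_comp]
    refine (hC _ (hf.iterate j hS)).trans ?_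
    rw [pow_succ', mul_assoc]
    exact mul_le_mul_right ih C

/-- The classes in `L^p` of bounded functions `g` with `g ∘ f^[P] = g` for some `P ≥ 1`. -/
def boundedPeriodic (𝕜 : Type*) [RCLike 𝕜] (f : X → X) (μ : Measure X) (p : ℝ≥0∞) :
    Set (Lp 𝕜 p μ) :=
  {y | ∃ (g : X → 𝕜) (hg : MemLp g p μ) (M : ℝ) (P : ℕ), 1 ≤ P ∧ StronglyMeasurable g ∧
    (∀ x, ‖g x‖ ≤ M) ∧ g ∘ f^[P] = g ∧ y = hg.toLp g}

variable [Fact (1 ≤ p)] {f : X → X} {T : Lp 𝕜 p μ →L[𝕜] Lp 𝕜 p μ}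

namespace IsCompositionOperator

lemma exists_measure_preimage_le [IsFiniteMeasure μ] (hp : p ≠ ∞) (hf : Measurable f)
    (hT : IsCompositionOperator f T) :
    ∃ C : ℝ≥0∞, C ≠ ∞ ∧ ∀ S, MeasurableSet S → μ (f ⁻¹' S) ≤ C * μ S := by
  have hp0 : p ≠ 0 := (zero_lt_one.trans_le (Fact.out : 1 ≤ p)).ne'
  have hp' : 0 < p.toReal := ENNReal.toReal_pos hp0 hp
  refine ⟨‖T‖ₑ ^ p.toReal, ENNReal.rpow_ne_top_of_nonneg hp'.le enorm_ne_top, fun S hS => ?_⟩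
  have hi : MemLp (S.indicator fun _ => (1 : 𝕜)) p μ :=
    memLp_indicator_const p hS 1 (Or.inr (measure_ne_top μ S))
  have h1 := T.le_opENorm (hi.toLp _)
  rw [Lp.enorm_toLp, Lp.enorm_def, eLpNorm_congr_ae (hT _ hi),
    show (S.indicator fun _ => (1 : 𝕜)) ∘ f = (f ⁻¹' S).indicator fun _ => 1 from rfl,
    eLpNorm_indicator_const hS hp0 hp,
    eLpNorm_indicator_const (hf hS) hp0 hp, enorm_one, one_mul, one_mul] at h1
  have h2 := ENNReal.rpow_le_rpow h1 hp'.le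
  rwa [ENNReal.mul_rpow_of_nonneg _ _ hp'.le, ← ENNReal.rpow_mul, ← ENNReal.rpow_mul,
    one_div_mul_cancel hp'.ne', ENNReal.rpow_one, ENNReal.rpow_one] at h2

lemma quasiMeasurePreserving [IsFiniteMeasure μ] (hp : p ≠ ∞) (hf : Measurable f)
    (hT : IsCompositionOperator f T) : Measure.QuasiMeasurePreserving f μ μ := by
  obtain ⟨C, -, hC⟩ := hT.exists_measure_preimage_le hp hf
  refine ⟨hf, Measure.AbsolutelyContinuous.mk fun S hS h0 => ?_⟩
  rw [Measure.map_apply hf hS]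
  exact le_zero_iff.1 ((hC S hS).trans (by rw [h0, mul_zero]))

lemma pow_apply_ae [IsFiniteMeasure μ] (hp : p ≠ ∞) (hf : Measurable f)
    (hT : IsCompositionOperator f T) (φ : Lp 𝕜 p μ) (n : ℕ) :
    (T ^ n) φ =ᵐ[μ] φ ∘ f^[n] := by
  induction n with
  | zero => exact ae_eq_refl _
  | succ n ih =>
    have h1 := hT _ (Lp.memLp ((T ^ n) φ))
    rw [Lp.toLp_coeFn] at h1
    rw [pow_succ', Function.iterate_succ]
    exact h1.trans ((hT.quasiMeasurePreserving hp hf).ae_eq_comp ih)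

lemma pow_toLp_ae [IsFiniteMeasure μ] (hp : p ≠ ∞) (hf : Measurable f)
    (hT : IsCompositionOperator f T) {φ : X → 𝕜} (hφ : MemLp φ p μ) (n : ℕ) :
    (T ^ n) (hφ.toLp φ) =ᵐ[μ] φ ∘ f^[n] :=
  (hT.pow_apply_ae hp hf _ n).trans
    (((hT.quasiMeasurePreserving hp hf).iterate n).ae_eq_comp hφ.coeFn_toLp)

lemma pow_apply_of_periodic [IsFiniteMeasure μ] (hp : p ≠ ∞) (hf : Measurable f)
    (hT : IsCompositionOperator f T) {y : Lp 𝕜 p μ} (hy : y ∈ boundedPeriodic 𝕜 f μ p) :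
    ∃ n : ℕ, 1 ≤ n ∧ (T ^ n) y = y := by
  obtain ⟨g, hg, -, P, hP, -, -, hgP, rfl⟩ := hy
  refine ⟨P, hP, Lp.ext ((hT.pow_toLp_ae hp hf hg P).trans ?_)⟩
  rw [hgP]
  exact hg.coeFn_toLp.symm

/-- If bounded periodic functions are dense and `f` is runaway, then `T` is transitive: given
bounded periodic `g₁` and `g₂`, glue `g₁` on a large set `B` to a function on its complement which
is carried by `f^[n]` to `g₂`. Periodicity supplies such a function without inverting `f`. -/
lemma isHypercyclic_of_isRunaway [IsProbabilityMeasure μ] [IsSeparable μ] (hp : p ≠ ∞)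
    (hf : Measurable f) (hT : IsCompositionOperator f T) (hd : Dense (boundedPeriodic 𝕜 f μ p))
    (hr : IsRunaway f μ) : IsHypercyclic T := by
  have hp0 : p ≠ 0 := (zero_lt_one.trans_le (Fact.out : 1 ≤ p)).ne'
  have : Fact (p ≠ ∞) := ⟨hp⟩
  refine isHypercyclic_of_transitive fun U V hU hV hUne hVne => ?_
  obtain ⟨_, ⟨g₁, hg₁, M₁, -, -, hm₁, hM₁, -, rfl⟩, h₁⟩ := hd.exists_mem_open hU hUne
  obtain ⟨_, ⟨g₂, hg₂, M₂, P, hP, hm₂, hM₂, hP₂, rfl⟩, h₂⟩ := hd.exists_mem_open hV hVne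
  obtain ⟨δ₁, hδ₁, hU'⟩ := EMetric.isOpen_iff.1 hU _ h₁
  obtain ⟨δ₂, hδ₂, hV'⟩ := EMetric.isOpen_iff.1 hV _ h₂
  set M := M₁ + M₂
  obtain ⟨ε, hε, hlt⟩ : ∃ ε : ℝ≥0∞, 0 < ε ∧
      ∀ m < ε, ENNReal.ofReal M * m ^ (1 / p.toReal) < min δ₁ δ₂ := by
    have hp' : 0 < 1 / p.toReal := one_div_pos.2 (ENNReal.toReal_pos hp0 hp)
    have h := ENNReal.Tendsto.const_mul (a := ENNReal.ofReal M)
      ((ENNReal.continuous_rpow_const (y := 1 / p.toReal)).tendsto 0) (Or.inr ENNReal.ofReal_ne_top)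
    rw [ENNReal.zero_rpow_of_pos hp', mul_zero] at h
    obtain ⟨ε, hε, hsub⟩ := ENNReal.nhds_zero_basis.eventually_iff.1
      (h.eventually (gt_mem_nhds (lt_min hδ₁ hδ₂)))
    exact ⟨ε, hε, fun m hm => hsub hm⟩
  obtain ⟨B, n, hn, hB, hB1, hB2⟩ := hr.exists_one_le hε
  -- a function that `f^[n]` carries to `g₂`
  set g := g₂ ∘ f^[(P - 1) * n]
  have hgn : ∀ x, g (f^[n] x) = g₂ x := by
    intro x
    have h3 : ∀ m, g₂ ∘ f^[P * m] = g₂ := fun m => by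
      induction m with
      | zero => rfl
      | succ m ih => rw [mul_add, mul_one, Function.iterate_add, ← Function.comp_assoc, ih, hP₂]
    have h4 : (P - 1) * n + n = P * n := by
      rw [← Nat.succ_mul, Nat.succ_eq_add_one, Nat.sub_add_cancel hP]
    change g₂ (f^[(P - 1) * n] (f^[n] x)) = g₂ x
    rw [← Function.iterate_add_apply, h4]
    exact congrFun (h3 n) x
  classical
  set φ := B.piecewise g₁ g
  have hφB : ∀ x ∈ B, φ x = g₁ x := fun x hx => Set.piecewise_eq_of_mem _ _ _ hx
  have hφB' : ∀ x ∉ B, φ x = g x := fun x hx => Set.piecewise_eq_of_notMem _ _ _ hx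
  have hφm : StronglyMeasurable φ :=
    hm₁.piecewise hB (hm₂.comp_measurable (hf.iterate _))
  have hg : ∀ x, ‖g x‖ ≤ M₂ := fun x => hM₂ _
  have hM₁0 : ∀ x : X, 0 ≤ M₁ := fun x => (norm_nonneg _).trans (hM₁ x)
  have hM₂0 : ∀ x : X, 0 ≤ M₂ := fun x => (norm_nonneg _).trans (hM₂ x)
  have hφ : MemLp φ p μ := by
    refine MemLp.of_bound hφm.aestronglyMeasurable M (ae_of_all _ fun x => ?_)
    by_cases hx : x ∈ B
    · rw [hφB x hx]; linarith [hM₁ x, hM₂0 x]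
    · rw [hφB' x hx]; linarith [hg x, hM₁0 x]
  refine ⟨n, hn, hφ.toLp φ, hU' ?_, hV' ?_⟩
  · rw [Metric.mem_eball, Lp.edist_toLp_toLp]
    refine ((eLpNorm_le_of_bound_of_support hp0 hp (M := M) hB.compl (fun x => ?_)
      fun x hx => ?_).trans_lt (hlt _ hB1)).trans_le (min_le_left _ _)
    · by_cases hx : x ∈ B
      · rw [Pi.sub_apply, hφB x hx, sub_self, norm_zero]
        exact add_nonneg (hM₁0 x) (hM₂0 x)
      · rw [Pi.sub_apply, hφB' x hx]
        refine (norm_sub_le _ _).trans ?_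
        linarith [hg x, hM₁ x]
    · rw [Pi.sub_apply, hφB x (by simpa using hx), sub_self]
  · have h5 : ((T ^ n) (hφ.toLp φ) - hg₂.toLp g₂ : Lp 𝕜 p μ) =ᵐ[μ] φ ∘ f^[n] - g₂ :=
      (Lp.coeFn_sub _ _).trans ((hT.pow_toLp_ae hp hf hφ n).sub hg₂.coeFn_toLp)
    rw [Metric.mem_eball, edist_eq_enorm_sub, Lp.enorm_def, eLpNorm_congr_ae h5]
    refine ((eLpNorm_le_of_bound_of_support hp0 hp (M := M) (hf.iterate n hB) (fun x => ?_)
      fun x hx => ?_).trans_lt (hlt _ hB2)).trans_le (min_le_right _ _)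
    · by_cases hx : f^[n] x ∈ B
      · rw [Pi.sub_apply, Function.comp_apply, hφB _ hx]
        exact (norm_sub_le _ _).trans (add_le_add (hM₁ _) (hM₂ _))
      · rw [Pi.sub_apply, Function.comp_apply, hφB' _ hx, hgn, sub_self, norm_zero]
        exact add_nonneg (hM₁0 x) (hM₂0 x)
    · rw [Pi.sub_apply, Function.comp_apply, hφB' _ hx, hgn, sub_self]

/-- A vector with `liminf ‖T ^ n x‖ = 0` yields, as a superlevel set, a set of positive measure
with preimages of arbitrarily small measure. -/
lemma exists_measure_preimage_lt_of_isLiYorkeChaotic [IsFiniteMeasure μ] (hp : p ≠ ∞)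
    (hf : Measurable f) (hT : IsCompositionOperator f T) (h : IsLiYorkeChaotic T) :
    ∃ B, MeasurableSet B ∧ μ B ≠ 0 ∧ ∀ ε : ℝ≥0∞, 0 < ε → ∃ n : ℕ, μ (f^[n] ⁻¹' B) < ε := by
  have hp0 : p ≠ 0 := (zero_lt_one.trans_le (Fact.out : 1 ≤ p)).ne'
  obtain ⟨x, hinf, hsup⟩ := h
  have hx0 : x ≠ 0 := by
    rintro rfl
    simp at hsup
  obtain ⟨δ, hδ, hδ0⟩ : ∃ δ : ℝ≥0∞, 0 < δ ∧ μ {z | δ ≤ ‖x z‖ₑ} ≠ 0 := by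
    by_contra! h0
    refine hx0 ((Lp.eq_zero_iff_ae_eq_zero).2 ?_)
    have h1 : ∀ᵐ z ∂μ, ∀ n : ℕ, ¬ ((n : ℝ≥0∞) + 1)⁻¹ ≤ ‖x z‖ₑ :=
      ae_all_iff.2 fun n => measure_eq_zero_iff_ae_notMem.1 (h0 _ (by simp))
    filter_upwards [h1] with z hz
    by_contra hne
    obtain ⟨n, hn⟩ := ENNReal.exists_inv_nat_lt (enorm_ne_zero.2 hne)
    exact hz n ((ENNReal.inv_le_inv.2 le_self_add).trans hn.le)
  refine ⟨{z | δ ≤ ‖x z‖ₑ}, measurableSet_le measurable_const (Lp.stronglyMeasurable x).enorm, hδ0,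
    fun ε hε => ?_⟩
  have hη : 0 < min δ 1 * (min ε 1) ^ (1 / p.toReal) := by
    refine ENNReal.mul_pos (lt_min hδ one_pos).ne' (ENNReal.rpow_pos (lt_min hε one_pos) ?_).ne'
    exact ((min_le_right _ _).trans_lt ENNReal.one_lt_top).ne
  obtain ⟨n, hn⟩ := (frequently_lt_of_liminf_lt (by isBoundedDefault) (hinf.trans_lt hη)).exists
  rw [Lp.enorm_def] at hn
  have h2 := measure_lt_of_eLpNorm_lt hp0 hp (Lp.aestronglyMeasurable _) hn
  refine ⟨n, lt_of_le_of_lt ?_ (h2.trans_le (min_le_left _ _))⟩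
  refine measure_mono_ae ?_
  filter_upwards [hT.pow_apply_ae hp hf x n] with z hz hδz
  change min δ 1 ≤ ‖((T ^ n) x : X → 𝕜) z‖ₑ
  rw [hz]
  exact (min_le_left _ _).trans hδz

/-- Let multiples of `T ^ n₁ φ` and `T ^ n₂ φ` be close to `1` and to `4 ^ r`, off sets `S₁` and `S₂`
of small measure. If `n₁ ≤ n₂`, then `4 ^ r` is nearly constant on the preimage of `S₁ᶜ` under the
`n₂ - n₁`-th iterate, so that this preimage is small. If `n₂ ≤ n₁`, then the `n₁ - n₂`-th iterate
maps `S₁ᶜ` into the union of `S₂` and one level set of `r`, which is a small set. -/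
lemma isRunaway_of_isSupercyclic [IsProbabilityMeasure μ] (hp : p ≠ ∞) (hf : Measurable f)
    (hT : IsCompositionOperator f T)
    (hpart : ∀ ε : ℝ≥0∞, 0 < ε → ∃ (r : X → ℕ) (P : ℕ), Measurable r ∧ (∀ x, r x < P) ∧
      ∀ m, μ (r ⁻¹' {m}) < ε)
    (h : IsSupercyclic T) : IsRunaway f μ := by
  have hp0 : p ≠ 0 := (zero_lt_one.trans_le (Fact.out : 1 ≤ p)).ne'
  obtain ⟨φ, hφ⟩ := h
  -- every class is approximated in measure by a multiple of an orbit element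
  have key : ∀ (ψ : X → 𝕜) (hψ : MemLp ψ p μ) (ε : ℝ≥0∞), 0 < ε → ε ≤ 1 → ∃ (c : 𝕜) (n : ℕ),
      μ {x | ¬ ‖c * φ (f^[n] x) - ψ x‖ < 1 / 8} < ε := by
    intro ψ hψ ε hε hε1
    set δ : ℝ≥0∞ := ENNReal.ofReal (1 / 8)
    have hδ : 0 < δ := ENNReal.ofReal_pos.2 (by norm_num)
    have hη : 0 < δ * ε ^ (1 / p.toReal) := ENNReal.mul_pos hδ.ne'
      (ENNReal.rpow_pos hε (hε1.trans_lt ENNReal.one_lt_top).ne).ne'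
    obtain ⟨y, ⟨c, n, -, rfl⟩, hy⟩ := hφ.exists_mem_open (Metric.isOpen_eball (x := hψ.toLp ψ))
      ⟨_, Metric.mem_eball_self hη⟩
    rw [Metric.mem_eball, edist_eq_enorm_sub, Lp.enorm_def] at hy
    refine ⟨c, n, lt_of_le_of_lt ?_
      (measure_lt_of_eLpNorm_lt hp0 hp (Lp.aestronglyMeasurable _) hy)⟩
    refine measure_mono_ae ?_
    filter_upwards [Lp.coeFn_sub (c • (T ^ n) φ) (hψ.toLp ψ), Lp.coeFn_smul c ((T ^ n) φ),
      hT.pow_apply_ae hp hf φ n, hψ.coeFn_toLp] with x h1 h2 h3 h4 h5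
    change δ ≤ ‖(c • (T ^ n) φ - hψ.toLp ψ : Lp 𝕜 p μ) x‖ₑ
    rw [h1, Pi.sub_apply, h2, Pi.smul_apply, h3, h4, ← ofReal_norm]
    exact ENNReal.ofReal_le_ofReal (not_lt.1 h5)
  intro ε₀ hε₀
  set ε := min (ε₀ / 2) (1 / 2) with hεdef
  have hε : 0 < ε := lt_min (ENNReal.half_pos hε₀.ne') (by simp)
  have hε1 : ε < 1 := (min_le_right _ _).trans_lt (by simp)
  have hεε : ε + ε ≤ ε₀ :=
    (add_le_add (min_le_left _ _) (min_le_left _ _)).trans (ENNReal.add_halves _).le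
  obtain ⟨r, P, hr, hrP, hrε⟩ := hpart ε hε
  have hψm : Measurable fun x => (4 : 𝕜) ^ r x :=
    (measurable_of_countable fun m : ℕ => (4 : 𝕜) ^ m).comp hr
  have hψ : MemLp (fun x => (4 : 𝕜) ^ r x) p μ := by
    refine MemLp.of_bound hψm.aestronglyMeasurable (4 ^ P) (ae_of_all _ fun x => ?_)
    rw [norm_pow, RCLike.norm_ofNat]
    exact pow_le_pow_right₀ (by norm_num) (hrP x).le
  obtain ⟨c₁, n₁, h₁⟩ := key (fun _ => 1) (memLp_const 1) ε hε hε1.le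
  obtain ⟨c₂, n₂, h₂⟩ := key _ hψ ε hε hε1.le
  set S₁ := {x | ¬ ‖c₁ * φ (f^[n₁] x) - 1‖ < 1 / 8}
  set S₂ := {x | ¬ ‖c₂ * φ (f^[n₂] x) - 4 ^ r x‖ < 1 / 8}
  have hφm : Measurable φ := (Lp.stronglyMeasurable φ).measurable
  have hS₁ : MeasurableSet S₁ :=
    (measurableSet_lt (((hφm.comp (hf.iterate n₁)).const_mul c₁).sub measurable_const).norm
      measurable_const).compl
  have hS₂ : MeasurableSet S₂ :=
    (measurableSet_lt (((hφm.comp (hf.iterate n₂)).const_mul c₂).sub hψm).norm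
      measurable_const).compl
  have hne : ∀ S : Set X, μ S < ε → ∃ x, x ∉ S := by
    intro S hS
    by_contra! h0
    rw [Set.eq_univ_of_forall h0, measure_univ] at hS
    exact hS.not_gt hε1
  have hc₁ : c₁ ≠ 0 := by
    rintro rfl
    obtain ⟨x, hx⟩ := hne S₁ h₁
    have := not_not.1 hx
    norm_num at this
  have hc₂ : c₂ ≠ 0 := by
    rintro rfl
    obtain ⟨x, hx⟩ := hne S₂ h₂
    have h3 := not_not.1 hx
    rw [zero_mul, zero_sub, norm_neg, norm_pow, RCLike.norm_ofNat] at h3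
    have : (1 : ℝ) ≤ 4 ^ r x := one_le_pow₀ (by norm_num)
    linarith
  -- a set on which `r` is constant has small measure
  have hconst : ∀ G : Set X, (∀ x ∈ G, ∀ y ∈ G, r x = r y) → μ G < ε := by
    intro G hG
    rcases G.eq_empty_or_nonempty with rfl | ⟨y, hy⟩
    · simpa using hε
    · exact (measure_mono fun x hx => hG x hx y hy).trans_lt (hrε (r y))
  rcases le_total n₁ n₂ with hle | hle
  · obtain ⟨N, rfl⟩ := Nat.exists_eq_add_of_le' hle
    set d := c₂ / c₁
    have hd : ∀ x ∈ f^[N] ⁻¹' S₁ᶜ \ S₂, ‖d - 4 ^ r x‖ < ‖d‖ / 8 + 1 / 8 := by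
      rintro x ⟨hx1, hx2⟩
      have e1 : ‖c₁ * φ (f^[n₁] (f^[N] x)) - 1‖ < 1 / 8 := not_not.1 hx1
      have e2 := not_not.1 hx2
      rw [add_comm N n₁, Function.iterate_add_apply] at e2
      set w := φ (f^[n₁] (f^[N] x))
      have e3 : d - 4 ^ r x = (c₂ * w - 4 ^ r x) - d * (c₁ * w - 1) := by
        rw [show c₂ = d * c₁ from (div_mul_cancel₀ _ hc₁).symm]; ring
      rw [e3]
      refine (norm_sub_le _ _).trans_lt ?_
      rw [norm_mul]
      have := mul_le_mul_of_nonneg_left e1.le (norm_nonneg d)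
      linarith
    refine ⟨S₁ᶜ, N, hS₁.compl, ?_, ?_⟩
    · rw [compl_compl]; exact h₁.trans_le (le_self_add.trans hεε)
    · have h3 := hconst _ fun x hx y hy => eq_of_norm_sub_four_pow_lt (hd x hx) (hd y hy)
      refine (measure_mono (Set.subset_sdiff_union _ S₂)).trans_lt ?_
      exact ((measure_union_le _ _).trans_lt (ENNReal.add_lt_add h3 h₂)).trans_le hεε
  · obtain ⟨N, rfl⟩ := Nat.exists_eq_add_of_le' hle
    set d := c₂ / c₁
    -- contained in one level set of `r`; it contains `f^[N] x` for `x ∉ S₁` unless `f^[N] x ∈ S₂`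
    set Z := {y | ‖d - 4 ^ r y‖ < ‖d‖ / 8 + 1 / 8}
    have hZ : μ Z < ε := hconst Z fun x hx y hy => eq_of_norm_sub_four_pow_lt hx hy
    have hZm : MeasurableSet Z :=
      measurableSet_lt (measurable_const.sub hψm).norm measurable_const
    refine ⟨(S₂ ∪ Z)ᶜ, N, (hS₂.union hZm).compl, ?_, ?_⟩
    · rw [compl_compl]
      exact ((measure_union_le _ _).trans_lt (ENNReal.add_lt_add h₂ hZ)).trans_le hεε
    · refine (measure_mono fun x hx => ?_).trans_lt (h₁.trans_le (le_self_add.trans hεε))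
      by_contra hx1
      refine hx (Or.inr ?_)
      have e1 := not_not.1 hx1
      have e2 : ‖c₂ * φ (f^[n₂] (f^[N] x)) - 4 ^ r (f^[N] x)‖ < 1 / 8 :=
        not_not.1 fun h3 => hx (Or.inl h3)
      rw [add_comm N n₂, Function.iterate_add_apply] at e1
      set y := f^[N] x
      set w := φ (f^[n₂] y)
      have e3 : d - 4 ^ r y = (c₂ * w - 4 ^ r y) - d * (c₁ * w - 1) := by
        rw [show c₂ = d * c₁ from (div_mul_cancel₀ _ hc₁).symm]; ring
      rw [Set.mem_ofPred_eq, e3]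
      refine (norm_sub_le _ _).trans_lt ?_
      rw [norm_mul]
      have := mul_le_mul_of_nonneg_left e1.le (norm_nonneg d)
      linarith

end IsCompositionOperator

end Composition

end LinearDynamics

/-! ### The composition operator of the odometer -/

section OdometerComposition

open LinearDynamics

variable {α : ℕ → ℕ}

/-- Functions of finitely many digits are bounded and periodic, and they are dense because
continuous functions are: `φ ∘ clearTail k` converges to `φ` pointwise and boundedly. -/
lemma dense_boundedPeriodic_odometer (𝕜 : Type*) [RCLike 𝕜] {p : ℝ≥0∞} [Fact (1 ≤ p)] (hp : p ≠ ∞)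
    (hα : ∀ n, 2 ≤ α n) (μ : Measure (∀ n, Fin (α n))) [IsFiniteMeasure μ] :
    Dense (boundedPeriodic 𝕜 (odometer α) μ p) := by
  refine Dense.of_closure ((BoundedContinuousFunction.toLp_denseRange 𝕜 μ 𝕜 hp).mono ?_)
  rintro _ ⟨φ, rfl⟩
  have hmem : ∀ k, MemLp (φ ∘ clearTail k) p μ := fun k =>
    .of_bound (φ.continuous.comp (continuous_clearTail k)).aestronglyMeasurable ‖φ‖
      (ae_of_all _ fun x => φ.norm_coe_le_norm _)
  have hφ : MemLp (⇑φ) p μ :=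
    .of_bound φ.continuous.aestronglyMeasurable ‖φ‖ (ae_of_all _ φ.norm_coe_le_norm)
  have hlim : Tendsto (fun k => eLpNorm (φ ∘ clearTail k - ⇑φ) p μ) atTop (𝓝 0) := by
    refine tendsto_Lp_finite_of_tendsto_ae Fact.out hp
      (fun k => (hmem k).aestronglyMeasurable) hφ ?_
      (ae_of_all _ fun x => (φ.continuous.tendsto x).comp (tendsto_clearTail x))
    refine unifIntegrable_of Fact.out hp (fun k => (hmem k).aestronglyMeasurable) fun ε _ =>
      ⟨‖φ‖₊ + 1, fun k => ?_⟩
    have : {x | ‖φ‖₊ + 1 ≤ ‖(φ ∘ clearTail k) x‖₊} = ∅ := by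
      refine Set.eq_empty_of_forall_notMem fun x hx => ?_
      have h1 : ‖(φ ∘ clearTail k) x‖₊ ≤ ‖φ‖₊ := φ.norm_coe_le_norm _
      exact absurd (lt_add_one ‖φ‖₊) (not_lt.2 ((show _ ≤ _ from hx).trans h1))
    rw [this, Set.indicator_empty]
    simp
  refine mem_closure_of_tendsto (f := fun k => (hmem k).toLp _) (b := atTop) ?_
    (Eventually.of_forall fun k => ⟨_, hmem k, ‖φ‖, ∏ j ∈ Finset.range k, α j,
      Finset.prod_pos fun j _ => zero_lt_two.trans_le (hα j),
      (φ.continuous.comp (continuous_clearTail k)).stronglyMeasurable,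
      fun x => φ.norm_coe_le_norm _, ?_, rfl⟩)
  · have h0 : BoundedContinuousFunction.toLp p μ 𝕜 φ = hφ.toLp φ :=
      Lp.ext ((BoundedContinuousFunction.coeFn_toLp _ _ _ φ).trans hφ.coeFn_toLp.symm)
    rw [h0, tendsto_iff_edist_tendsto_0]
    simpa only [Lp.edist_toLp_toLp] using hlim
  · funext x
    exact congrArg φ (clearTail_odometer_iterate k x)

/-- If some set of positive measure has preimages of arbitrarily small measure, then so do its
tail saturations, whose measure is close to `1`. -/
lemma isRunaway_odometer (ν : ∀ n, Measure (Fin (α n))) [∀ n, IsProbabilityMeasure (ν n)]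
    {C : ℝ≥0∞} (hC : C ≠ ∞) (hCμ : ∀ S, MeasurableSet S →
      Measure.infinitePi ν (odometer α ⁻¹' S) ≤ C * Measure.infinitePi ν S)
    {B : Set (∀ n, Fin (α n))} (hB : MeasurableSet B) (h0 : Measure.infinitePi ν B ≠ 0)
    (hn : ∀ ε : ℝ≥0∞, 0 < ε → ∃ n : ℕ, Measure.infinitePi ν ((odometer α)^[n] ⁻¹' B) < ε) :
    IsRunaway (odometer α) (Measure.infinitePi ν) := by
  intro ε hε
  set μ := Measure.infinitePi ν
  obtain ⟨k, hk⟩ : ∃ k, μ (tailSaturation k B)ᶜ < ε := by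
    have h1 := tendsto_measure_iUnion_atTop (μ := μ) (monotone_tailSaturation B)
    rw [measure_iUnion_tailSaturation ν hB h0] at h1
    obtain ⟨k, hk⟩ := (h1.eventually (lt_mem_nhds
      (ENNReal.sub_lt_self ENNReal.one_ne_top one_ne_zero hε.ne'))).exists
    refine ⟨k, ?_⟩
    rw [prob_compl_eq_one_sub (measurableSet_tailSaturation k hB)]
    exact ENNReal.sub_lt_of_sub_lt prob_le_one (Or.inl ENNReal.one_ne_top) hk
  set P := ∏ j ∈ Finset.range k, α j
  set K : ℝ≥0∞ := ∑ j ∈ Finset.range (2 * P), C ^ j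
  have hK : K ≠ ∞ := ENNReal.sum_ne_top.2 fun j _ => ENNReal.pow_ne_top hC
  obtain ⟨n, hn⟩ := hn _ (ENNReal.div_pos hε.ne' hK)
  refine ⟨tailSaturation k B, n + P, measurableSet_tailSaturation k hB, hk, ?_⟩
  calc μ ((odometer α)^[n + P] ⁻¹' tailSaturation k B)
      ≤ ∑ j ∈ Finset.range (2 * P), μ ((odometer α)^[n + j] ⁻¹' B) :=
        (measure_mono (preimage_tailSaturation_subset k n B)).trans
          (measure_biUnion_finset_le _ _)
    _ ≤ ∑ j ∈ Finset.range (2 * P), C ^ j * μ ((odometer α)^[n] ⁻¹' B) := by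
        refine Finset.sum_le_sum fun j _ => ?_
        rw [Function.iterate_add, Set.preimage_comp]
        exact measure_iterate_preimage_le (measurable_odometer α) hCμ
          ((measurable_odometer α).iterate n hB) j
    _ = K * μ ((odometer α)^[n] ⁻¹' B) := (Finset.sum_mul _ _ _).symm
    _ < ε := ENNReal.mul_lt_of_lt_div' hn

end OdometerComposition

theorem theoremC {𝕜 : Type*} [RCLike 𝕜] (p : ℝ≥0∞) [Fact (1 ≤ p)] (hp : p ≠ ∞)
    (α : ℕ → ℕ) (hα : ∀ n, 2 ≤ α n)
    (ν : ∀ n, Measure (Fin (α n))) [∀ n, IsProbabilityMeasure (ν n)]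
    (hpos : ∀ (n : ℕ) (a : Fin (α n)), 0 < ν n {a})
    (hna : Tendsto (fun N : ℕ => ∏ n ∈ Finset.range N, ⨆ a : Fin (α n), ν n {a}) atTop (𝓝 0))
    (T : Lp 𝕜 p (Measure.infinitePi ν) →L[𝕜] Lp 𝕜 p (Measure.infinitePi ν))
    (hT : LinearDynamics.IsCompositionOperator (odometer α) T) :
    List.TFAE [LinearDynamics.IsLiYorkeChaotic T, LinearDynamics.IsSupercyclic T,
      LinearDynamics.IsHypercyclic T, LinearDynamics.IsDevaneyChaotic T] := by
  have hf := measurable_odometer α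
  have hnt : Nontrivial (Lp 𝕜 p (Measure.infinitePi ν)) := by
    refine ⟨(memLp_const (1 : 𝕜)).toLp _, 0, fun h => ?_⟩
    have h1 := (MemLp.coeFn_toLp (memLp_const (1 : 𝕜))).symm.trans (Lp.eq_zero_iff_ae_eq_zero.1 h)
    obtain ⟨x, hx⟩ := h1.exists
    exact one_ne_zero hx
  have hd := dense_boundedPeriodic_odometer 𝕜 hp hα (Measure.infinitePi ν)
  tfae_have 1 → 3 := fun h => by
    obtain ⟨C, hC, hCμ⟩ := hT.exists_measure_preimage_le hp hf
    obtain ⟨B, hB, h0, hn⟩ := hT.exists_measure_preimage_lt_of_isLiYorkeChaotic hp hf h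
    exact hT.isHypercyclic_of_isRunaway hp hf hd (isRunaway_odometer ν hC hCμ hB h0 hn)
  tfae_have 2 → 3 := fun h => by
    refine hT.isHypercyclic_of_isRunaway hp hf hd
      (hT.isRunaway_of_isSupercyclic hp hf (fun ε hε => ?_) h)
    obtain ⟨k, hk⟩ := (hna.eventually (gt_mem_nhds hε)).exists
    exact ⟨digitValue k, _, measurable_digitValue k, digitValue_lt k, fun m =>
      (measure_digitValue_fiber_le ν k m).trans_lt hk⟩
  tfae_have 3 → 1 := LinearDynamics.IsHypercyclic.isLiYorkeChaotic
  tfae_have 3 → 2 := LinearDynamics.IsHypercyclic.isSupercyclic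
  tfae_have 3 → 4 := fun h => ⟨h, hd.mono fun y hy => hT.pow_apply_of_periodic hp hf hy⟩
  tfae_have 4 → 3 := fun h => h.1
  tfae_finish
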